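/- Let $R$ be an integral domain with fraction field $K$, let $A$ be an associative unital $R$-algebra which is free of finite rank as an $R$-module, and let $\mathfrak p$ be a prime ideal of $R$ with residue field $k(\mathfrak p)=\operatorname{Frac}(R/\mathfrak p)$. For a commutative $R$-algebra $S$ write $A^S=S\otimes_R A$, and write $A(\mathfrak p)=A^{k(\mathfrak p)}$. A finite-dimensional algebra $B$ over a field $k$ *splits* if $\operatorname{End}_B(S)=k$ for every simple $B$-module $S$; $\operatorname{Jac}(B)$ denotes its Jacobson radical, and $\mathrm G_0(B)$ the Grothendieck group (with respect to short exact sequences) of the category of finite-dimensional $B$-modules. Let $\mathcal O$ be a local ring with $R\subseteq\mathcal O\subseteq K$, maximal ideal $\mathfrak m$ and residue field $k(\mathfrak m)=\mathcal O/\mathfrak m$. For an $A^K$-module $V$, an *$\mathcal O$-free $A^{\mathcal O}$-form* of $V$ is an $A^{\mathcal O}$-module $\widetilde V$ which is free over $\mathcal O$ and satisfies $K\otimes_{\mathcal O}\widetilde V\cong V$ as $A^K$-modules. If $R\cap\mathfrak m=\mathfrak p$, let $\gamma:\mathrm G_0(A(\mathfrak p))\to\mathrm G_0(A^{k(\mathfrak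 m)})$ be the (injective) morphism induced by scalar extension along $k(\mathfrak p)\hookrightarrow k(\mathfrak m)$. We call $\mathcal O$ an *$A$-gate in $\mathfrak p$* if 1. $R\cap\mathfrak m=\mathfrak p$; 2. every finite-dimensional $A^K$-module has an $\mathcal O$-free $A^{\mathcal O}$-form; 3. $[\widetilde V/\mathfrak m\widetilde V]$ lies in the image of $\gamma$ for every finitely generated $A^{\mathcal O}$-module $\widetilde V$ that is free over $\mathcal O$. It is a *discrete* $A$-gate if moreover $\mathcal O$ is a discrete valuation ring. The *decomposition map* of $A$ in $\mathfrak p$ with respect to an $A$-gate $\mathcal O$ is the unique group homomorphism $\mathrm d_A^{\mathfrak p,\mathcal O}:\mathrm G_0(A^K)\to\mathrm G_0(A(\mathfrak p))$ such that $\gamma(\mathrm d_A^{\mathfrak p,\mathcal O}([V]))=[\widetilde V/\mathfrak m\widetilde V]$ for every finite-dimensional $A^K$-module $V$ and every $\mathcal O$-free $A^{\mathcal O}$-form $\widetilde V$ of $V$. It is *trivial* if it induces a bijection between the isomorphism classes of simple $A^K$-modules and those of simple $A(\mathfrak p)$-modules. **Theorem.** Suppose that $A^K$ and $A(\mathfrak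 p)$ split, and let $\mathcal O$ be a discrete $A$-gate in $\mathfrak p$. If $$\dim_{k(\mathfrak p)}\operatorname{Jac}(A(\mathfrak p))=\dim_K\operatorname{Jac}(A^K),$$ then the decomposition map $\mathrm d_A^{\mathfrak p,\mathcal O}$ exists, is unique, and is trivial. -/

import Mathlib

open scoped TensorProduct
open IsLocalRing (maximalIdeal ResidueField)

universe u

namespace DecompositionMaps

noncomputable section

/-! ### Split algebras -/

/-- An algebra `B` over a field `k` is split if `End_B(S) = k` for every simple `B`-module `S`. -/
def IsSplitAlgebra (k B : Type u) [Field k] [Ring B] [Algebra k B] : Prop :=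
  ∀ (S : Type u) [AddCommGroup S] [Module B S] [IsSimpleModule B S] (f : Module.End B S),
    ∃ c : k, ∀ s : S, f s = algebraMap k B c • s

/-! ### The Grothendieck group of finitely generated modules -/

section Grothendieck

variable (B : Type u) [Ring B]

/-- The relations `[M] = [M'] + [M'']`, one for each short exact sequence `0 → M' → M → M'' → 0`
of finitely generated `B`-modules. -/
def G0Relations : Set (FreeAbelianGroup (FGModuleCat.{u} B)) :=
  {x | ∃ (M' M M'' : FGModuleCat.{u} B) (f : M' →ₗ[B] M) (g : M →ₗ[B] M''),
    Function.Injective f ∧ Function.Exact f g ∧ Function.Surjective g ∧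
      x = .of M - .of M' - .of M''}

/-- The Grothendieck group of the category of finitely generated `B`-modules. For a
finite-dimensional algebra `B` over a field these are the finite-dimensional modules. -/
def G0 : Type (u + 1) :=
  FreeAbelianGroup (FGModuleCat.{u} B) ⧸ AddSubgroup.closure (G0Relations B)

instance : AddCommGroup (G0 B) :=
  inferInstanceAs (AddCommGroup
    (FreeAbelianGroup (FGModuleCat.{u} B) ⧸ AddSubgroup.closure (G0Relations B)))

variable {B}

/-- The class `[M]` of a finitely generated module `M`. -/
def G0.cls (M : FGModuleCat.{u} B) : G0 B :=
  QuotientAddGroup.mk' (AddSubgroup.closure (G0Relations B)) (.of M)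

theorem G0.cls_eq_add {M' M M'' : FGModuleCat.{u} B} (f : M' →ₗ[B] M) (g : M →ₗ[B] M'')
    (hf : Function.Injective f) (hfg : Function.Exact f g) (hg : Function.Surjective g) :
    G0.cls M = G0.cls M' + G0.cls M'' := by
  have h : QuotientAddGroup.mk' (AddSubgroup.closure (G0Relations B))
      (FreeAbelianGroup.of M - .of M' - .of M'') = 0 :=
    (QuotientAddGroup.eq_zero_iff _).2
      (AddSubgroup.subset_closure ⟨M', M, M'', f, g, hf, hfg, hg, rfl⟩)
  rw [map_sub, map_sub, sub_sub, sub_eq_zero] at h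
  exact h

theorem G0.cls_eq_of_equiv {M N : FGModuleCat.{u} B} (e : M ≃ₗ[B] N) :
    G0.cls M = G0.cls N := by
  have h0 : G0.cls (FGModuleCat.of B PUnit.{u + 1}) = 0 := by
    have h := G0.cls_eq_add (M' := FGModuleCat.of B PUnit.{u + 1})
      (M := FGModuleCat.of B PUnit.{u + 1}) (M'' := FGModuleCat.of B PUnit.{u + 1})
      LinearMap.id 0 Function.injective_id (fun x => by simp) (fun x => ⟨x, rfl⟩)
    simpa using h
  have h := G0.cls_eq_add (M' := M) (M := N) (M'' := FGModuleCat.of B PUnit.{u + 1})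
    e.toLinearMap 0 e.injective (fun x => by simp) (fun x => ⟨0, rfl⟩)
  rw [h0, add_zero] at h
  exact h.symm

/-- A function on finitely generated modules that is additive on short exact sequences
defines a homomorphism on the Grothendieck group. -/
def G0.lift {G : Type*} [AddCommGroup G] (φ : FGModuleCat.{u} B → G)
    (h : ∀ (M' M M'' : FGModuleCat.{u} B) (f : M' →ₗ[B] M) (g : M →ₗ[B] M''),
      Function.Injective f → Function.Exact f g → Function.Surjective g →
        φ M = φ M' + φ M'') : G0 B →+ G :=
  QuotientAddGroup.lift (AddSubgroup.closure (G0Relations B)) (FreeAbelianGroup.lift φ) (by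
    rw [AddSubgroup.closure_le]
    rintro x ⟨M', M, M'', f, g, hf, hfg, hg, rfl⟩
    simp [h M' M M'' f g hf hfg hg])

@[simp]
theorem G0.lift_cls {G : Type*} [AddCommGroup G] (φ : FGModuleCat.{u} B → G) (h)
    (M : FGModuleCat.{u} B) : G0.lift φ h (G0.cls M) = φ M :=
  FreeAbelianGroup.lift_apply_of φ M

variable (B)

/-- Isomorphism of simple modules. -/
def simpleSetoid : Setoid {S : FGModuleCat.{u} B // IsSimpleModule B S} where
  r S T := Nonempty (S.1 ≃ₗ[B] T.1)
  iseqv := ⟨fun _ => ⟨.refl B _⟩, fun ⟨e⟩ => ⟨e.symm⟩, fun ⟨e⟩ ⟨e'⟩ => ⟨e.trans e'⟩⟩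

/-- The set of isomorphism classes of simple `B`-modules. -/
def SimpleClass : Type (u + 1) := Quotient (simpleSetoid B)

variable {B}

/-- The class in the Grothendieck group of an isomorphism class of simple modules. -/
def SimpleClass.cls : SimpleClass B → G0 B :=
  Quotient.lift (fun S => G0.cls S.1) fun _ _ ⟨e⟩ => G0.cls_eq_of_equiv e

/-- A homomorphism of Grothendieck groups is trivial if it induces a bijection between the
isomorphism classes of simple modules. -/
def IsTrivial {C : Type u} [Ring C] (d : G0 B →+ G0 C) : Prop :=
  ∃ e : SimpleClass B ≃ SimpleClass C, ∀ S : SimpleClass B, d S.cls = (e S).cls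

end Grothendieck

/-! ### Extension of scalars

For commutative `R`-algebras `S → S'` and a module `V` over `A^S = S ⊗[R] A`, the `S'`-module
`S' ⊗[S] V` is a module over `A^S' = S' ⊗[R] A`. -/

section BaseChange

variable {R A S : Type u} [CommRing R] [Ring A] [Algebra R A] [CommRing S] [Algebra R S]

/-- A module over `S ⊗[R] A` is an `S`-module. -/
instance (V : FGModuleCat.{u} (S ⊗[R] A)) : Module S V :=
  Module.compHom V (algebraMap S (S ⊗[R] A))

instance (V : FGModuleCat.{u} (S ⊗[R] A)) : IsScalarTower S (S ⊗[R] A) V :=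
  IsScalarTower.of_algebraMap_smul fun _ _ => rfl

instance (V : FGModuleCat.{u} (S ⊗[R] A)) : SMulCommClass (S ⊗[R] A) S V :=
  IsScalarTower.to_smulCommClass'

variable (S' : Type u) [CommRing S'] [Algebra R S'] [Algebra S S'] [IsScalarTower R S S']

/-- The action of `A` on `S' ⊗[S] V`: `a • (t ⊗ v) = t ⊗ ((1 ⊗ a) • v)`. -/
def extendScalarsRep (V : FGModuleCat.{u} (S ⊗[R] A)) : A →ₐ[R] Module.End S' (S' ⊗[S] V) where
  toFun := fun a => (Algebra.lsmul S S V ((1 : S) ⊗ₜ[R] a)).baseChange S'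
  map_one' := by
   rw [← Algebra.TensorProduct.one_def, map_one]; exact LinearMap.baseChange_id
  map_mul' := fun a b => by
   rw [← LinearMap.baseChange_mul, ← map_mul]; simp
  map_zero' := by simp
  map_add' := fun a b => by rw [TensorProduct.tmul_add, map_add, LinearMap.baseChange_add]
  commutes' := fun r => by
   have h : (1 : S) ⊗ₜ[R] algebraMap R A r =
       algebraMap S (S ⊗[R] A) (algebraMap R S r) := by
     rw [Algebra.TensorProduct.algebraMap_apply, Algebra.algebraMap_self_apply,
       Algebra.algebraMap_eq_smul_one, Algebra.algebraMap_eq_smul_one,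
       TensorProduct.tmul_smul, TensorProduct.smul_tmul']
   refine TensorProduct.AlgebraTensorModule.curry_injective ?_
   ext v
   change (1 : S') ⊗ₜ[S] (((1 : S) ⊗ₜ[R] algebraMap R A r) • v) = r • ((1 : S') ⊗ₜ[S] v)
   rw [h, algebraMap_smul, TensorProduct.tmul_smul, TensorProduct.smul_tmul',
     TensorProduct.smul_tmul', algebraMap_smul]

/-- The action of `S' ⊗[R] A` on `S' ⊗[S] V`:
`(s ⊗ a) • (t ⊗ v) = (s * t) ⊗ ((1 ⊗ a) • v)`. -/
def extendScalarsAction (V : FGModuleCat.{u} (S ⊗[R] A)) :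
    S' ⊗[R] A →ₐ[S'] Module.End S' (S' ⊗[S] V) :=
  Algebra.TensorProduct.lift (Algebra.ofId S' _) (extendScalarsRep S' V) fun s a => by
    rw [Algebra.ofId_apply]
    exact Algebra.commutes s _

theorem extendScalarsAction_tmul (V : FGModuleCat.{u} (S ⊗[R] A)) (s t : S') (a : A) (v : V) :
    extendScalarsAction S' V (s ⊗ₜ[R] a) (t ⊗ₜ[S] v) =
      (s * t) ⊗ₜ[S] (((1 : S) ⊗ₜ[R] a) • v) := by
  rw [extendScalarsAction, Algebra.TensorProduct.lift_tmul]
  rfl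

/-- The `S'`-module `S' ⊗[S] V`, as a module over `S' ⊗[R] A`. -/
def ExtendScalars (V : FGModuleCat.{u} (S ⊗[R] A)) : Type u := S' ⊗[S] V

instance (V : FGModuleCat.{u} (S ⊗[R] A)) : AddCommGroup (ExtendScalars S' V) :=
  inferInstanceAs (AddCommGroup (S' ⊗[S] V))

instance (V : FGModuleCat.{u} (S ⊗[R] A)) : Module (S' ⊗[R] A) (ExtendScalars S' V) :=
  letI : Module (Module.End S' (S' ⊗[S] V)) (ExtendScalars S' V) :=
    inferInstanceAs (Module (Module.End S' (S' ⊗[S] V)) (S' ⊗[S] V))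
  Module.compHom (ExtendScalars S' V) (extendScalarsAction S' V).toRingHom

/-- The element `t ⊗ v` of `S' ⊗[S] V`. -/
def ExtendScalars.tmul {V : FGModuleCat.{u} (S ⊗[R] A)} (t : S') (v : V) : ExtendScalars S' V :=
  t ⊗ₜ[S] v

theorem ExtendScalars.tmul_smul_tmul {V : FGModuleCat.{u} (S ⊗[R] A)} (s t : S') (a : A) (v : V) :
    (s ⊗ₜ[R] a) • ExtendScalars.tmul S' t v =
      ExtendScalars.tmul S' (s * t) (((1 : S) ⊗ₜ[R] a) • v) :=
  extendScalarsAction_tmul S' V s t a v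

instance (V : FGModuleCat.{u} (S ⊗[R] A)) :
    Module.Finite (S' ⊗[R] A) (ExtendScalars S' V) := by
  obtain ⟨X, hX⟩ := (inferInstance : Module.Finite (S ⊗[R] A) V).fg_top
  classical
  let j : V → ExtendScalars S' V := ExtendScalars.tmul S' 1
  have j0 : j 0 = 0 := TensorProduct.tmul_zero _ _
  have keyS : ∀ (b : S ⊗[R] A) (v : V),
      j v ∈ Submodule.span (S' ⊗[R] A) (j '' X) → j (b • v) ∈ Submodule.span (S' ⊗[R] A) (j '' X) := by
    intro b v hv
    induction b using TensorProduct.induction_on with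
    | zero =>
      rw [zero_smul, j0]
      exact Submodule.zero_mem _
    | add b c hb hc =>
      have : j ((b + c) • v) = j (b • v) + j (c • v) := by
        rw [add_smul]; exact TensorProduct.tmul_add _ _ _
      rw [this]; exact Submodule.add_mem _ hb hc
    | tmul s a =>
      have : j ((s ⊗ₜ[R] a) • v) = (algebraMap S S' s ⊗ₜ[R] a) • j v := by
        refine Eq.trans ?_ (ExtendScalars.tmul_smul_tmul S' _ _ _ _).symm
        have h2 : (s ⊗ₜ[R] a : S ⊗[R] A) = s • ((1 : S) ⊗ₜ[R] a) := by
          rw [TensorProduct.smul_tmul', smul_eq_mul, mul_one]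
        show (1 : S') ⊗ₜ[S] ((s ⊗ₜ[R] a) • v) = _
        rw [h2, smul_assoc, TensorProduct.tmul_smul, TensorProduct.smul_tmul', mul_one,
          Algebra.smul_def, mul_one]
        rfl
      rw [this]; exact Submodule.smul_mem _ _ hv
  have hj : ∀ v : V, j v ∈ Submodule.span (S' ⊗[R] A) (j '' X) := by
    intro v
    have hv : v ∈ Submodule.span (S ⊗[R] A) (X : Set V) := by rw [hX]; trivial
    induction hv using Submodule.span_induction with
    | mem v hv => exact Submodule.subset_span ⟨v, hv, rfl⟩
    | zero => rw [j0]; exact Submodule.zero_mem _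
    | add v w _ _ hv hw =>
      have : j (v + w) = j v + j w := TensorProduct.tmul_add _ _ _
      rw [this]; exact Submodule.add_mem _ hv hw
    | smul b v _ hv => exact keyS b v hv
  refine ⟨⟨X.image j, ?_⟩⟩
  rw [Finset.coe_image, eq_top_iff]
  rintro (x : S' ⊗[S] V) -
  induction x using TensorProduct.induction_on with
  | zero => exact Submodule.zero_mem _
  | add x y hx hy => exact Submodule.add_mem _ hx hy
  | tmul t v =>
    have : ExtendScalars.tmul S' t v = (t ⊗ₜ[R] (1 : A)) • j v := by
      refine Eq.trans ?_ (ExtendScalars.tmul_smul_tmul S' _ _ _ _).symm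
      rw [← Algebra.TensorProduct.one_def, one_smul, mul_one]
    exact (this ▸ Submodule.smul_mem _ _ (hj v) :
      ExtendScalars.tmul S' t v ∈ Submodule.span (S' ⊗[R] A) (j '' X))

/-- The scalar extension `V ↦ S' ⊗[S] V` from finitely generated `A^S`-modules to finitely
generated `A^S'`-modules. -/
def extendScalars (V : FGModuleCat.{u} (S ⊗[R] A)) : FGModuleCat.{u} (S' ⊗[R] A) :=
  FGModuleCat.of (S' ⊗[R] A) (ExtendScalars S' V)

/-- Scalar extension of a homomorphism. -/
def extendScalarsMap {V W : FGModuleCat.{u} (S ⊗[R] A)} (f : V →ₗ[S ⊗[R] A] W) :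
    extendScalars S' V →ₗ[S' ⊗[R] A] extendScalars S' W :=
  let g : S' ⊗[S] V →ₗ[S'] S' ⊗[S] W := (f.restrictScalars S).baseChange S'
  { toFun := g
    map_add' := g.map_add
    map_smul' := by
      intro b (x : S' ⊗[S] V)
      show g (extendScalarsAction S' V b x) = extendScalarsAction S' W b (g x)
      induction b using TensorProduct.induction_on with
      | zero => simp
      | add b c hb hc => simp only [map_add, LinearMap.add_apply, hb, hc]
      | tmul s a =>
        induction x using TensorProduct.induction_on with
        | zero => simp
        | add x y hx hy => simp only [map_add, hx, hy]
        | tmul t v => simp [g, extendScalarsAction_tmul] }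

/-- The homomorphism of Grothendieck groups induced by a flat extension of scalars. -/
def G0.extendScalars [Module.Flat S S'] : G0 (S ⊗[R] A) →+ G0 (S' ⊗[R] A) :=
  G0.lift (fun V => G0.cls (DecompositionMaps.extendScalars S' V))
    fun _ _ _ f g hf hfg hg =>
      G0.cls_eq_add (extendScalarsMap S' f) (extendScalarsMap S' g)
        (Module.Flat.lTensor_preserves_injective_linearMap (M := S') (f.restrictScalars S) hf)
        (Module.Flat.lTensor_exact S' (f := f.restrictScalars S) (g := g.restrictScalars S) hfg)
        (LinearMap.lTensor_surjective S' (g := g.restrictScalars S) hg)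

end BaseChange

/-! ### Gates and decomposition maps -/

section Gates

variable {R K : Type u} [CommRing R] [Field K] [Algebra R K]

/-- The embedding `k(p) → k(m)` of residue fields for a local ring `O` between `R` and `K` whose
maximal ideal `m` satisfies `R ∩ m = p`. -/
def residueFieldMap (p : Ideal R) [p.IsPrime] (O : Subalgebra R K) [IsLocalRing O]
    (h : (maximalIdeal O).comap (algebraMap R O) = p) :
    p.ResidueField →ₐ[R] ResidueField O :=
  Ideal.ResidueField.liftₐ p (Algebra.ofId R (ResidueField O))
    (fun r hr => by
      rw [← h, Ideal.mem_comap, ← IsLocalRing.residue_eq_zero_iff] at hr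
      exact hr)
    (fun r hr => by
      have hr' : r ∉ p := hr
      rw [← h, Ideal.mem_comap, ← IsLocalRing.residue_eq_zero_iff] at hr'
      exact isUnit_iff_ne_zero.2 hr')

variable (A : Type u) [Ring A] [Algebra R A]

/-- The homomorphism `G₀(A(p)) → G₀(A^O(m))` given by extension of scalars along the embedding
`k(p) → k(m)`. -/
def residueG0Map (p : Ideal R) [p.IsPrime] (O : Subalgebra R K) [IsLocalRing O]
    (h : (maximalIdeal O).comap (algebraMap R O) = p) :
    G0 (p.ResidueField ⊗[R] A) →+ G0 (ResidueField O ⊗[R] A) :=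
  letI : Algebra p.ResidueField (ResidueField O) := (residueFieldMap p O h).toRingHom.toAlgebra
  haveI : IsScalarTower R p.ResidueField (ResidueField O) :=
    .of_algebraMap_eq fun r => ((residueFieldMap p O h).commutes r).symm
  G0.extendScalars (ResidueField O)

variable {A}

/-- A finitely generated `A^O`-module `W` is an `O`-free `A^O`-form of the `A^K`-module `V` if it
is free over `O` and `K ⊗[O] W ≅ V` as `A^K`-modules. -/
def IsFreeForm (O : Subalgebra R K) (W : FGModuleCat.{u} (O ⊗[R] A))
    (V : FGModuleCat.{u} (K ⊗[R] A)) : Prop :=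
  Module.Free O W ∧ Nonempty (extendScalars K W ≃ₗ[K ⊗[R] A] V)

/-- The class in `G₀(A^O(m))` of the reduction `W / m W = k(m) ⊗[O] W` of an `A^O`-module `W`. -/
def reductionClass (O : Subalgebra R K) [IsLocalRing O] (W : FGModuleCat.{u} (O ⊗[R] A)) :
    G0 (ResidueField O ⊗[R] A) :=
  G0.cls (extendScalars (ResidueField O) W)

variable (A)

/-- `O` is a weak `A`-gate in `p`: a local ring between `R` and `K` with maximal ideal `m` such
that `R ∩ m = p` and every finite-dimensional `A^K`-module has an `O`-free `A^O`-form. -/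
structure IsWeakGate (p : Ideal R) (O : Subalgebra R K) [IsLocalRing O] : Prop where
  comap_eq : (maximalIdeal O).comap (algebraMap R O) = p
  exists_form : ∀ V : FGModuleCat.{u} (K ⊗[R] A),
    ∃ W : FGModuleCat.{u} (O ⊗[R] A), IsFreeForm O W V

/-- `O` is an `A`-gate in `p`: a weak `A`-gate such that the classes of reductions of finitely
generated `O`-free `A^O`-modules lie in the image of `G₀(A(p))`. -/
structure IsGate (p : Ideal R) [p.IsPrime] (O : Subalgebra R K) [IsLocalRing O] : Prop
    extends IsWeakGate A p O where
  reduction_mem : ∀ W : FGModuleCat.{u} (O ⊗[R] A), Module.Free O W →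
    reductionClass O W ∈ (residueG0Map A p O comap_eq).range

variable {A}

/-- The property that characterizes the decomposition map `d : G₀(A^K) → G₀(A(p))` with respect
to an `A`-gate `O`: for every finite-dimensional `A^K`-module `V` and every `O`-free `A^O`-form `W`
of `V`, the image of `d [V]` in `G₀(A^O(m))` is the class of the reduction `W / m W`. -/
def IsDecompositionMap {p : Ideal R} [p.IsPrime] {O : Subalgebra R K} [IsLocalRing O]
    (hO : IsGate A p O) (d : G0 (K ⊗[R] A) →+ G0 (p.ResidueField ⊗[R] A)) : Prop :=
  ∀ (V : FGModuleCat.{u} (K ⊗[R] A)) (W : FGModuleCat.{u} (O ⊗[R] A)), IsFreeForm O W V →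
    residueG0Map A p O hO.comap_eq (d (G0.cls V)) = reductionClass O W

end Gates

end

end DecompositionMaps

namespace DecompositionMaps

noncomputable section

/-! ### Characteristic polynomials and short exact sequences -/

section Charpoly

variable {k V : Type*} [Field k] [AddCommGroup V] [Module k V] [Module.Finite k V]

/-! The argument is of Brauer–Nesbitt type. If `A(p)` splits, density gives for each simple module
`T` an element `a_T` that acts on `T` with eigenvalue `1` of algebraic multiplicity one and by zero
on the other simples. Counting the root `1` of its characteristic polynomial therefore counts the
composition factors `T`; unlike a trace, this count is an integer in every characteristic.

Move `a_T` to `A^k(m)` and lift it to `c` in `A^O`. The characteristic polynomial of `c` on a free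
form maps to the one on `V` over `K`. Since `O → K` is injective, it is independent of the form and
multiplicative on exact sequences of `A^K`-modules; reducing it modulo `m` gives additive functions
`δ_T` on `G0(A^K)`. A decomposition map must be `[V] ↦ Σ δ_T[V] [T]`, and the gate condition makes
this formula one (`exists_unique_isDecompositionMap`).

For triviality let `D` be the decomposition matrix, `n_S` and `m_T` the dimensions of the simples.
Then `n = D m`, and no column of `D` vanishes because regular modules specialize to regular modules.
In a split algebra the radical and the squared dimensions of the simples add up to the rank of `A`
(`finrank_jacobson_add_sum_sq`), so equal radicals give `Σ n_S² = Σ m_T²`. For a nonnegative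
integral matrix this forces a permutation matrix (`exists_equiv_of_sum_sq_eq`). -/

open Module in
theorem charpoly_eq_restrict_mul_mapQ (W : Submodule k V) (e : V →ₗ[k] V) (he : W ≤ W.comap e) :
    e.charpoly = (e.restrict he).charpoly * (W.mapQ W e he).charpoly := by
  classical
  let bW := Free.chooseBasis k W
  let bQ := Free.chooseBasis k (V ⧸ W)
  let b := Basis.sumQuot bW bQ
  -- In a basis adapted to `W` the matrix is block upper triangular; the corner block plays no role.
  suffices LinearMap.toMatrix b b e = Matrix.fromBlocks (LinearMap.toMatrix bW bW (e.restrict he))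
      (Matrix.of fun i l => (b.repr (e (b (Sum.inr l)))) (Sum.inl i)) 0
      (LinearMap.toMatrix bQ bQ (W.mapQ W e he)) by
    rw [← LinearMap.charpoly_toMatrix e b, this, ← LinearMap.charpoly_toMatrix _ bW,
      ← LinearMap.charpoly_toMatrix _ bQ, Matrix.charpoly_fromBlocks_zero₂₁]
  ext u v
  cases u with
  | inl i =>
    cases v with
    | inl l =>
      simp only [b, Basis.sumQuot_inl, Matrix.fromBlocks_apply₁₁, LinearMap.toMatrix_apply]
      apply Basis.sumQuot_repr_inl_of_mem
    | inr l => simp [b, LinearMap.toMatrix_apply, Matrix.fromBlocks_apply₁₂]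
  | inr j =>
    cases v with
    | inl l =>
      suffices W.mkQ (e (bW l)) = 0 by simp [LinearMap.toMatrix_apply, b, this]
      rw [← LinearMap.mem_ker, Submodule.ker_mkQ]
      exact he (Submodule.coe_mem (bW l))
    | inr l =>
      simp only [LinearMap.toMatrix_apply, Basis.sumQuot_repr_inr, Matrix.fromBlocks_apply₂₂, b]
      rw [← Basis.sumQuot_inr bW bQ l, W.mapQ_apply]
      simp

theorem charpoly_eq_of_equiv {S V W : Type*} [CommRing S] [AddCommGroup V] [Module S V]
    [Module.Finite S V] [Module.Free S V] [AddCommGroup W] [Module S W]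
    [Module.Finite S W] [Module.Free S W] (e : V ≃ₗ[S] W) (f : V →ₗ[S] V) (g : W →ₗ[S] W)
    (h : ∀ v, e (f v) = g (e v)) : f.charpoly = g.charpoly := by
  rw [← e.charpoly_conj f]
  congr 1
  ext w
  simp [LinearEquiv.conj_apply, h]

/-- This multiplicativity is what lets root multiplicities descend to the Grothendieck group. -/
theorem charpoly_eq_mul_of_exact {V' V'' : Type*} [AddCommGroup V'] [Module k V']
    [Module.Finite k V'] [AddCommGroup V''] [Module k V''] [Module.Finite k V'']
    {f : V' →ₗ[k] V} {g : V →ₗ[k] V''} (hf : Function.Injective f) (hfg : Function.Exact f g)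
    (hg : Function.Surjective g) {e' : V' →ₗ[k] V'} {e : V →ₗ[k] V} {e'' : V'' →ₗ[k] V''}
    (h' : ∀ v, f (e' v) = e (f v)) (h'' : ∀ v, g (e v) = e'' (g v)) :
    e.charpoly = e'.charpoly * e''.charpoly := by
  have he : LinearMap.ker g ≤ (LinearMap.ker g).comap e := fun v hv => by
    simp only [Submodule.mem_comap, LinearMap.mem_ker] at hv ⊢
    rw [h'', hv, map_zero]
  rw [charpoly_eq_restrict_mul_mapQ (LinearMap.ker g) e he]
  congr 1
  · symm
    refine charpoly_eq_of_equiv ((LinearEquiv.ofInjective f hf).trans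
      (LinearEquiv.ofEq _ _ hfg.linearMap_ker_eq.symm)) _ _ fun v => ?_
    ext
    simp [h']
  · refine charpoly_eq_of_equiv (g.quotKerEquivOfSurjective hg) _ _ fun v => ?_
    obtain ⟨v, rfl⟩ := Submodule.mkQ_surjective _ v
    simp [h'']

theorem finrank_eq_add_of_exact {V' V'' : Type*} [AddCommGroup V'] [Module k V']
    [AddCommGroup V''] [Module k V'']
    {f : V' →ₗ[k] V} {g : V →ₗ[k] V''} (hf : Function.Injective f) (hfg : Function.Exact f g)
    (hg : Function.Surjective g) :
    Module.finrank k V = Module.finrank k V' + Module.finrank k V'' := by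
  rw [← LinearMap.finrank_range_add_finrank_ker g, hfg.linearMap_ker_eq,
    LinearMap.finrank_range_of_inj hf, LinearMap.range_eq_top.2 hg, finrank_top, add_comm]

end Charpoly

/-! ### Counting in a nonnegative integral matrix -/

/-- A nonnegative integral matrix `D` without zero columns that maps a positive vector `m` to a
positive vector of the same Euclidean length is a permutation matrix. -/
theorem exists_equiv_of_sum_sq_eq {ι κ : Type*} [Fintype ι] [Fintype κ] (D : ι → κ → ℕ)
    (m : κ → ℕ) (hm : ∀ j, 0 < m j) (hn : ∀ i, 0 < ∑ j, D i j * m j)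
    (hD : ∀ j, ∃ i, D i j ≠ 0) (h : ∑ i, (∑ j, D i j * m j) ^ 2 = ∑ j, m j ^ 2) :
    ∃ e : ι ≃ κ, ∀ i, D i (e i) = 1 ∧ ∀ j, j ≠ e i → D i j = 0 := by
  classical
  choose f hf using hD
  have h1 : ∀ i, ∑ j, (D i j * m j) ^ 2 ≤ (∑ j, D i j * m j) ^ 2 := fun i =>
    Finset.sum_sq_le_sq_sum_of_nonneg (fun _ _ => Nat.zero_le _)
  have h2 : ∀ j, m j ^ 2 ≤ ∑ i, (D i j * m j) ^ 2 := fun j => by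
    refine le_trans ?_ (Finset.single_le_sum (f := fun i => (D i j * m j) ^ 2)
      (fun _ _ => Nat.zero_le _) (Finset.mem_univ (f j)))
    exact Nat.pow_le_pow_left (Nat.le_mul_of_pos_left _ (Nat.pos_of_ne_zero (hf j))) 2
  have hswap : ∑ i, ∑ j, (D i j * m j) ^ 2 = ∑ j, ∑ i, (D i j * m j) ^ 2 := Finset.sum_comm
  have hle1 := Finset.sum_le_sum fun i (_ : i ∈ Finset.univ) => h1 i
  have hle2 := Finset.sum_le_sum fun j (_ : j ∈ Finset.univ) => h2 j
  -- In `Σ m_j² ≤ Σ (D i j m_j)² ≤ Σ_i (Σ_j D i j m_j)²` the two ends agree by `h`, so every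
  -- termwise inequality is an equality.
  have e1 : ∀ i, ∑ j, (D i j * m j) ^ 2 = (∑ j, D i j * m j) ^ 2 := fun i =>
    (Finset.sum_eq_sum_iff_of_le fun i _ => h1 i).1 (by omega) i (Finset.mem_univ i)
  have e2 : ∀ j, m j ^ 2 = ∑ i, (D i j * m j) ^ 2 := fun j =>
    (Finset.sum_eq_sum_iff_of_le fun i _ => h2 i).1 (by omega) j (Finset.mem_univ j)
  have hone : ∀ j, D (f j) j = 1 := fun j => by
    have := Finset.single_le_sum (f := fun i => (D i j * m j) ^ 2)
      (fun _ _ => Nat.zero_le _) (Finset.mem_univ (f j))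
    rw [← e2 j] at this
    have h3 := (Nat.pow_le_pow_iff_left two_ne_zero).1 this
    have h4 : D (f j) j ≤ 1 := Nat.le_of_mul_le_mul_right (by simpa using h3) (hm j)
    have := hf j
    omega
  -- The entry in row `f j` already exhausts `m_j²`, leaving no room for another one in the column.
  have huniq : ∀ i j, D i j ≠ 0 → i = f j := fun i j hij => by
    by_contra hne
    have := Finset.add_le_sum (f := fun i => (D i j * m j) ^ 2)
      (fun _ _ => Nat.zero_le _) (Finset.mem_univ i) (Finset.mem_univ (f j)) hne
    rw [← e2 j] at this
    simp only [hone, one_mul] at this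
    have : 0 < (D i j * m j) ^ 2 := by have := hm j; positivity
    omega
  -- Two nonzero entries in a row produce a positive cross term in the square of the row sum,
  -- against `e1`.
  have hrow : ∀ i j j', D i j ≠ 0 → D i j' ≠ 0 → j = j' := fun i j j' hj hj' => by
    by_contra hne
    have hlt : ∑ l, (D i l * m l) ^ 2 < ∑ l, (D i l * m l) * ∑ l', D i l' * m l' := by
      refine Finset.sum_lt_sum (fun l _ => ?_) ⟨j, Finset.mem_univ j, ?_⟩
      · rw [sq]
        exact Nat.mul_le_mul_left _ (Finset.single_le_sum (f := fun l => D i l * m l)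
          (fun _ _ => Nat.zero_le _) (Finset.mem_univ l))
      · rw [sq]
        have hpos : 0 < D i j * m j := by have := hm j; positivity
        have hpos' : 0 < D i j' * m j' := by have := hm j'; positivity
        have := Finset.add_le_sum (f := fun l => D i l * m l)
          (fun _ _ => Nat.zero_le _) (Finset.mem_univ j) (Finset.mem_univ j') hne
        exact Nat.mul_lt_mul_of_pos_left (by omega) hpos
    rw [e1, ← Finset.sum_mul, ← sq] at hlt
    exact lt_irrefl _ hlt
  have hex : ∀ i, ∃ j, D i j ≠ 0 := fun i => by
    by_contra! hz
    have := hn i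
    simp [hz] at this
  choose g hg using hex
  refine ⟨⟨g, f, fun i => (huniq i _ (hg i)).symm, fun j =>
    hrow (f j) _ _ (hg _) (hf j)⟩, fun i => ⟨?_, fun j hj => ?_⟩⟩
  · have := hone (g i)
    rwa [← huniq i _ (hg i)] at this
  · by_contra hne
    exact hj (hrow i _ _ hne (hg i))

/-! ### The action of a fixed element and extension of scalars -/

section Action

variable {R A S : Type u} [CommRing R] [Ring A] [Algebra R A] [CommRing S] [Algebra R S]

instance [Module.Finite R A] (V : FGModuleCat.{u} (S ⊗[R] A)) : Module.Finite S V :=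
  Module.Finite.trans (S ⊗[R] A) V

/-- The action of `b` on `V` as an `S`-linear map. -/
def action (V : FGModuleCat.{u} (S ⊗[R] A)) (b : S ⊗[R] A) : V →ₗ[S] V :=
  Algebra.lsmul S S V b

@[simp]
theorem action_apply (V : FGModuleCat.{u} (S ⊗[R] A)) (b : S ⊗[R] A) (v : V) :
    action V b v = b • v := rfl

variable (A) (S' : Type u) [CommRing S'] [Algebra R S'] [Algebra S S'] [IsScalarTower R S S']

/-- The homomorphism `A^S → A^S'`. -/
def scalarMap : S ⊗[R] A →ₐ[R] S' ⊗[R] A :=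
  Algebra.TensorProduct.map (IsScalarTower.toAlgHom R S S') (AlgHom.id R A)

@[simp]
theorem scalarMap_tmul (s : S) (a : A) :
    scalarMap A S' (s ⊗ₜ[R] a) = algebraMap S S' s ⊗ₜ[R] a := by
  simp [scalarMap]

variable {A}

/-- The `S'`-structure obtained by restriction from `A^S'` must be matched with that of the left
tensor factor before facts about `LinearMap.baseChange` apply. -/
theorem extendScalars_smul (V : FGModuleCat.{u} (S ⊗[R] A)) (s : S') (x : extendScalars S' V) :
    s • x = (s • (show S' ⊗[S] V from x) : S' ⊗[S] V) := by
  change extendScalarsAction S' V (algebraMap S' (S' ⊗[R] A) s) x = _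
  rw [AlgHom.commutes]
  rfl

/-- The underlying `S'`-module of `extendScalars S' V` is `S' ⊗[S] V`. -/
def extendScalarsEquiv (V : FGModuleCat.{u} (S ⊗[R] A)) :
    extendScalars S' V ≃ₗ[S'] S' ⊗[S] V where
  toFun x := x
  invFun x := x
  map_add' _ _ := rfl
  map_smul' := extendScalars_smul S' V
  left_inv _ := rfl
  right_inv _ := rfl

theorem extendScalarsEquiv_smul (V : FGModuleCat.{u} (S ⊗[R] A)) (b : S ⊗[R] A)
    (x : extendScalars S' V) :
    extendScalarsEquiv S' V (scalarMap A S' b • x) =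
      (action V b).baseChange S' (extendScalarsEquiv S' V x) := by
  suffices ∀ y : S' ⊗[S] V, extendScalarsAction S' V (scalarMap A S' b) y =
      (action V b).baseChange S' y from this x
  intro y
  induction b using TensorProduct.induction_on with
  | zero => simp [action]
  | add b c hb hc =>
    rw [map_add, map_add, LinearMap.add_apply, hb, hc]
    simp [action]
  | tmul s a =>
    induction y using TensorProduct.induction_on with
    | zero => simp
    | add x y hx hy => simp only [map_add, hx, hy]
    | tmul t v =>
      have h : s ⊗ₜ[R] a = s • ((1 : S) ⊗ₜ[R] a) := by
        rw [TensorProduct.smul_tmul', smul_eq_mul, mul_one]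
      rw [scalarMap_tmul, extendScalarsAction_tmul, LinearMap.baseChange_tmul, action_apply,
        h, smul_assoc, ← TensorProduct.smul_tmul s, Algebra.smul_def]

instance (V : FGModuleCat.{u} (S ⊗[R] A)) [Module.Free S V] :
    Module.Free S' (extendScalars S' V) :=
  .of_equiv (extendScalarsEquiv S' V).symm

/-- The image of `b` acts as the base change of the action of `b`. This compares the fibres along `O
→ K`, `O → k(m)` and `k(p) → k(m)`. -/
theorem charpoly_action_extendScalars [Module.Finite R A] (V : FGModuleCat.{u} (S ⊗[R] A))
    [Module.Free S V]     (b : S ⊗[R] A) :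
    (action (extendScalars S' V) (scalarMap A S' b)).charpoly =
      (action V b).charpoly.map (algebraMap S S') := by
  rw [← LinearMap.charpoly_baseChange]
  exact charpoly_eq_of_equiv (extendScalarsEquiv S' V) _ _
    fun v => extendScalarsEquiv_smul S' V b v

theorem finrank_extendScalars [Nontrivial S] [Nontrivial S'] (V : FGModuleCat.{u} (S ⊗[R] A))
    [Module.Free S V] :
    Module.finrank S' (extendScalars S' V) = Module.finrank S V := by
  rw [(extendScalarsEquiv S' V).finrank_eq, Module.finrank_baseChange]

theorem charpoly_action_eq_of_equiv [Module.Finite R A] {V W : FGModuleCat.{u} (S ⊗[R] A)}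
    [Module.Free S V] [Module.Free S W] (e : V ≃ₗ[S ⊗[R] A] W) (b : S ⊗[R] A) :
    (action V b).charpoly = (action W b).charpoly :=
  charpoly_eq_of_equiv (e.restrictScalars S) _ _ fun v => e.map_smul b v

variable (R A S)

/-- The regular module. -/
def regularModule : FGModuleCat.{u} (S ⊗[R] A) := FGModuleCat.of (S ⊗[R] A) (S ⊗[R] A)

/-- The regular module, as an `S`-module. -/
def regularEquiv : regularModule R A S ≃ₗ[S] S ⊗[R] A where
  toFun x := x
  invFun x := x
  map_add' _ _ := rfl
  map_smul' s x := (Algebra.smul_def (A := S ⊗[R] A) s x).symm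
  left_inv _ := rfl
  right_inv _ := rfl

/-- The scalar extension of the regular module is the regular module, as an `S'`-module. -/
def extendScalarsRegularLinearEquiv :
    S' ⊗[S] regularModule R A S ≃ₗ[S'] S' ⊗[R] A :=
  ((regularEquiv R A S).baseChange S S' _ _).trans
    (TensorProduct.AlgebraTensorModule.cancelBaseChange R S S' S' A)

theorem extendScalarsRegularLinearEquiv_tmul (t : S') (x : regularModule R A S) :
    extendScalarsRegularLinearEquiv R A S S' (t ⊗ₜ x) =
      t • scalarMap A S' (regularEquiv R A S x) := by
  rw [extendScalarsRegularLinearEquiv, LinearEquiv.trans_apply, LinearEquiv.baseChange_tmul]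
  generalize regularEquiv R A S x = x
  induction x using TensorProduct.induction_on with
  | zero => simp
  | add x y hx hy => rw [TensorProduct.tmul_add, map_add, map_add, smul_add, hx, hy]
  | tmul s a =>
    rw [TensorProduct.AlgebraTensorModule.cancelBaseChange_tmul, scalarMap_tmul,
      TensorProduct.smul_tmul', smul_eq_mul, Algebra.smul_def, mul_comm]

/-- The scalar extension of the regular module is the regular module. -/
def extendScalarsRegularEquiv :
    extendScalars S' (regularModule R A S) ≃ₗ[S' ⊗[R] A]
      regularModule R A S' :=
  { toFun := extendScalarsRegularLinearEquiv R A S S'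
    invFun := (extendScalarsRegularLinearEquiv R A S S').symm
    map_add' := (extendScalarsRegularLinearEquiv R A S S').map_add
    left_inv := (extendScalarsRegularLinearEquiv R A S S').symm_apply_apply
    right_inv := (extendScalarsRegularLinearEquiv R A S S').apply_symm_apply
    map_smul' := fun b x => by
      suffices ∀ y : S' ⊗[S] regularModule R A S,
        extendScalarsRegularLinearEquiv R A S S'
            (extendScalarsAction S' (regularModule R A S) b y) =
          b * extendScalarsRegularLinearEquiv R A S S' y from this x
      intro y
      induction b using TensorProduct.induction_on with
      | zero => simp
      | add b c hb hc => rw [map_add, LinearMap.add_apply, map_add, hb, hc, add_mul]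
      | tmul s a =>
        induction y using TensorProduct.induction_on with
        | zero => simp
        | add x y hx hy => rw [map_add, map_add, map_add, mul_add, hx, hy]
        | tmul t v =>
          have hv : regularEquiv R A S (((1 : S) ⊗ₜ[R] a) • v) =
              ((1 : S) ⊗ₜ[R] a) * regularEquiv R A S v := rfl
          rw [extendScalarsAction_tmul, extendScalarsRegularLinearEquiv_tmul,
            extendScalarsRegularLinearEquiv_tmul, hv, map_mul, scalarMap_tmul, map_one,
            mul_smul_comm, ← smul_mul_assoc, TensorProduct.smul_tmul', smul_eq_mul, mul_one,
            mul_comm s, ← smul_eq_mul t, ← TensorProduct.smul_tmul', smul_mul_assoc] }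

end Action

/-! ### Homomorphisms from Grothendieck groups over a field to the integers -/

section Field

variable {R A k : Type u} [CommRing R] [Ring A] [Algebra R A] [Module.Finite R A] [Field k]
  [Algebra R k]

theorem charpoly_action_eq_mul {V' V V'' : FGModuleCat.{u} (k ⊗[R] A)}
    {f : V' →ₗ[k ⊗[R] A] V} {g : V →ₗ[k ⊗[R] A] V''} (hf : Function.Injective f)
    (hfg : Function.Exact f g) (hg : Function.Surjective g) (b : k ⊗[R] A) :
    (action V b).charpoly = (action V' b).charpoly * (action V'' b).charpoly :=
  charpoly_eq_mul_of_exact (f := f.restrictScalars k) (g := g.restrictScalars k) hf hfg hg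
    (fun v => f.map_smul b v) (fun v => g.map_smul b v)

/-- The algebraic multiplicity of the eigenvalue `1` of `b` on `V`. -/
def eigenMult (V : FGModuleCat.{u} (k ⊗[R] A)) (b : k ⊗[R] A) : ℕ :=
  (action V b).charpoly.rootMultiplicity 1

theorem eigenMult_eq_add {V' V V'' : FGModuleCat.{u} (k ⊗[R] A)}
    {f : V' →ₗ[k ⊗[R] A] V} {g : V →ₗ[k ⊗[R] A] V''} (hf : Function.Injective f)
    (hfg : Function.Exact f g) (hg : Function.Surjective g) (b : k ⊗[R] A) :
    eigenMult V b = eigenMult V' b + eigenMult V'' b := by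
  rw [eigenMult, charpoly_action_eq_mul hf hfg hg, Polynomial.rootMultiplicity_mul]
  · rfl
  · exact mul_ne_zero (LinearMap.charpoly_monic _).ne_zero (LinearMap.charpoly_monic _).ne_zero

/-- The homomorphism `[V] ↦ eigenMult V b`. -/
def G0.eigenMult (b : k ⊗[R] A) : G0 (k ⊗[R] A) →+ ℤ :=
  G0.lift (fun V => (DecompositionMaps.eigenMult V b : ℤ)) fun _ _ _ _ _ hf hfg hg => by
    rw [eigenMult_eq_add hf hfg hg, Nat.cast_add]

@[simp]
theorem G0.eigenMult_cls (b : k ⊗[R] A) (V : FGModuleCat.{u} (k ⊗[R] A)) :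
    G0.eigenMult b (G0.cls V) = DecompositionMaps.eigenMult V b :=
  G0.lift_cls _ _ _

/-- The homomorphism `[V] ↦ dim V`. -/
def G0.dim : G0 (k ⊗[R] A) →+ ℤ :=
  G0.lift (fun V => (Module.finrank k V : ℤ)) fun _ _ _ f g hf hfg hg => by
    rw [finrank_eq_add_of_exact (f := f.restrictScalars k) (g := g.restrictScalars k) hf hfg hg,
      Nat.cast_add]

@[simp]
theorem G0.dim_cls (V : FGModuleCat.{u} (k ⊗[R] A)) :
    G0.dim (G0.cls V) = Module.finrank k V :=
  G0.lift_cls _ _ _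

theorem G0.hom_ext {B : Type u} [Ring B] {G : Type*} [AddCommGroup G] {φ ψ : G0 B →+ G}
    (h : ∀ V : FGModuleCat.{u} B, φ (G0.cls V) = ψ (G0.cls V)) : φ = ψ := by
  refine QuotientAddGroup.addMonoidHom_ext _ (FreeAbelianGroup.lift.symm.injective ?_)
  funext V
  exact h V

/-- Simple classes generate `G0`: split off a simple submodule and induct on the dimension. -/
theorem G0.hom_ext_simple {G : Type*} [AddCommGroup G] {φ ψ : G0 (k ⊗[R] A) →+ G}
    (h : ∀ S : SimpleClass (k ⊗[R] A), φ S.cls = ψ S.cls) : φ = ψ := by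
  refine G0.hom_ext fun V => ?_
  induction hn : Module.finrank k V using Nat.strong_induction_on generalizing V with
  | _ n ih =>
    have : IsArtinianRing (k ⊗[R] A) := IsArtinianRing.of_finite k _
    have : IsArtinian (k ⊗[R] A) V := inferInstance
    have : IsNoetherianRing (k ⊗[R] A) := IsNoetherianRing.of_finite k _
    have : IsNoetherian (k ⊗[R] A) V := inferInstance
    obtain hV | ⟨N, hN, -⟩ := eq_bot_or_exists_atom_le (⊤ : Submodule (k ⊗[R] A) V)
    -- For `V = 0` the sequence `V → V → V` given by `id` and `0` is short exact, so `[V] = [V] +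
    -- [V]`.
    · have h0 : (G0.cls V : G0 (k ⊗[R] A)) = 0 := by
        have h := G0.cls_eq_add (M' := V) (M := V) (M'' := V) LinearMap.id 0
          Function.injective_id (fun x => by simp)
          (fun x => ⟨0, by simpa using ((Submodule.eq_bot_iff _).1 hV x trivial).symm⟩)
        simpa using h
      rw [h0, map_zero, map_zero]
    · have hsimple : IsSimpleModule (k ⊗[R] A) N := isSimpleModule_iff_isAtom.2 hN
      let N' := FGModuleCat.of (k ⊗[R] A) N
      let Q := FGModuleCat.of (k ⊗[R] A) (V ⧸ N)
      let f : N' →ₗ[k ⊗[R] A] V := N.subtype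
      let g : V →ₗ[k ⊗[R] A] Q := N.mkQ
      have hf : Function.Injective f := N.injective_subtype
      have hfg : Function.Exact f g := LinearMap.exact_subtype_mkQ N
      have hg : Function.Surjective g := N.mkQ_surjective
      have hdim := finrank_eq_add_of_exact (f := f.restrictScalars k)
        (g := g.restrictScalars k) hf hfg hg
      have hpos : 0 < Module.finrank k N' := by
        have : Module.Finite k N' :=
          (fun V => inferInstance : ∀ V : FGModuleCat.{u} (k ⊗[R] A), Module.Finite k V) N'
        have : Nontrivial N' := IsSimpleModule.nontrivial (k ⊗[R] A) N
        exact Module.finrank_pos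
      rw [G0.cls_eq_add f g hf hfg hg, map_add, map_add, ih _ (by omega) Q rfl]
      congr 1
      exact h (Quotient.mk _ ⟨N', hsimple⟩)

end Field

/-! ### Simple modules of split algebras -/

section SimpleClass

variable {B : Type u} [Ring B]

/-- A representative of an isomorphism class of simple modules. -/
def SimpleClass.rep (S : SimpleClass B) : FGModuleCat.{u} B := (Quotient.out S).1

instance (S : SimpleClass B) : IsSimpleModule B S.rep := (Quotient.out S).2

theorem SimpleClass.cls_eq (S : SimpleClass B) : S.cls = G0.cls S.rep :=
  congrArg SimpleClass.cls (Quotient.out_eq S).symm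

theorem SimpleClass.eq_of_equiv {S T : SimpleClass B} (e : S.rep ≃ₗ[B] T.rep) : S = T :=
  Quotient.out_equiv_out.1 ⟨e⟩

theorem SimpleClass.exists_equiv (S : Type u) [AddCommGroup S] [Module B S] [IsSimpleModule B S] :
    ∃ T : SimpleClass B, Nonempty (S ≃ₗ[B] T.rep) := by
  have : Module.Finite B S := inferInstance
  obtain ⟨e⟩ := Quotient.mk_out (s := simpleSetoid B) ⟨FGModuleCat.of B S, ‹_›⟩
  exact ⟨Quotient.mk _ ⟨FGModuleCat.of B S, ‹_›⟩, ⟨e.symm⟩⟩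

/-- Maximal left ideals are exactly the annihilators of nonzero elements of simple modules. -/
theorem mem_jacobson_iff_forall_smul_eq_zero (b : B) :
    b ∈ Ring.jacobson B ↔ ∀ (S : SimpleClass B) (s : S.rep), b • s = 0 := by
  rw [Ring.jacobson_eq_sInf_isMaximal, Submodule.mem_sInf]
  constructor
  · intro h S s
    by_cases hs : s = 0
    · rw [hs, smul_zero]
    · have := h _ (Set.mem_ofPred.2 (IsSimpleModule.ker_toSpanSingleton_isMaximal B hs))
      simpa using this
  · intro h I hI
    have : Ideal.IsMaximal I := hI
    have : IsSimpleModule B (B ⧸ I) := isSimpleModule_iff_isCoatom.2 this.out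
    obtain ⟨T, ⟨e⟩⟩ := SimpleClass.exists_equiv (B := B) (B ⧸ I)
    have h1 : b • (Submodule.Quotient.mk 1 : B ⧸ I) = 0 := by
      apply e.injective
      rw [map_smul, h, map_zero]
    rwa [← Submodule.Quotient.mk_smul, smul_eq_mul, mul_one, Submodule.Quotient.mk_eq_zero] at h1

end SimpleClass

/-- A projection onto a coordinate line has characteristic polynomial `(X - 1) X^(n-1)`. -/
theorem exists_rootMultiplicity_charpoly_eq_one (k V : Type*) [Field k] [AddCommGroup V]
    [Module k V] [Module.Finite k V] [Nontrivial V] :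
    ∃ φ : V →ₗ[k] V, φ.charpoly.rootMultiplicity 1 = 1 := by
  classical
  let b := Module.Free.chooseBasis k V
  obtain ⟨i⟩ := b.index_nonempty
  refine ⟨Matrix.toLin b b (Matrix.diagonal (Pi.single i 1)), ?_⟩
  rw [Matrix.charpoly_toLin, Matrix.charpoly_diagonal,
    ← Finset.mul_prod_erase _ _ (Finset.mem_univ i),
    Finset.prod_congr rfl (g := fun _ => (Polynomial.X : Polynomial k)) fun j hj => by
    simp [Pi.single_eq_of_ne (Finset.ne_of_mem_erase hj)]]
  rw [Pi.single_eq_same, Finset.prod_const, Polynomial.rootMultiplicity_mul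
    (mul_ne_zero (Polynomial.X_sub_C_ne_zero 1) (pow_ne_zero _ Polynomial.X_ne_zero)),
    Polynomial.rootMultiplicity_X_sub_C_self, Polynomial.rootMultiplicity_eq_zero]
  simp

section Split

variable {R A k : Type u} [CommRing R] [Ring A] [Algebra R A] [Module.Finite R A] [Field k]
  [Algebra R k]

/-- The action of the algebra on a family of simple modules. -/
def simpleActions {ι : Type*} (T : ι → SimpleClass (k ⊗[R] A)) :
    k ⊗[R] A →ₗ[k] ∀ i, (T i).rep →ₗ[k] (T i).rep :=
  LinearMap.pi fun i => (Algebra.lsmul k k (T i).rep).toLinearMap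

/-- The density theorem for a split algebra. -/
theorem simpleActions_surjective (hs : IsSplitAlgebra k (k ⊗[R] A)) {ι : Type*} [Finite ι]
    {T : ι → SimpleClass (k ⊗[R] A)} (hT : Function.Injective T) :
    Function.Surjective (simpleActions T) := by
  classical
  intro φ
  have := Fintype.ofFinite ι
  let M := ∀ i, (T i).rep
  -- By Schur's lemma `g` has no off-diagonal components, and splitness makes the diagonal ones
  -- scalars. Hence `φ`, acting coordinatewise, commutes with every `g`, as the density theorem
  -- requires.
  have hM : ∀ (g : Module.End (k ⊗[R] A) M) (i : ι), ∃ c : k, ∀ m : M, g m i = c • m i := by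
    intro g i
    let gc : ∀ j, (T j).rep →ₗ[k ⊗[R] A] (T i).rep := fun j =>
      LinearMap.proj i ∘ₗ g ∘ₗ LinearMap.single (k ⊗[R] A) (fun j => (T j).rep) j
    have hgc : ∀ j, j ≠ i → gc j = 0 := fun j hj => by
      rcases LinearMap.bijective_or_eq_zero (gc j) with h | h
      · exact absurd (hT (SimpleClass.eq_of_equiv (LinearEquiv.ofBijective _ h))) hj
      · exact h
    obtain ⟨c, hc⟩ := hs (T i).rep (gc i)
    refine ⟨c, fun m => ?_⟩
    have hm : m = ∑ j, Pi.single j (m j) := (Finset.univ_sum_single m).symm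
    conv_lhs => rw [hm]
    rw [map_sum, Finset.sum_apply, Finset.sum_eq_single i]
    · exact hc (m i)
    · intro j _ hj
      exact LinearMap.congr_fun (hgc j hj) (m j)
    · simp
  let F : Module.End (Module.End (k ⊗[R] A) M) M :=
    { toFun := fun m i => φ i (m i)
      map_add' := fun m m' => by ext i; exact map_add _ _ _
      map_smul' := fun g m => by
        ext i
        obtain ⟨c, hc⟩ := hM g i
        change φ i (g m i) = g (fun i => φ i (m i)) i
        rw [hc, hc, map_smul] }
  let bas := fun i => Module.Free.chooseBasis k (T i).rep
  -- Agreement with `φ` on bases of all the factors is enough, by `k`-linearity.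
  obtain ⟨b, hb⟩ := jacobson_density F
    (Finset.univ.biUnion fun i => Finset.univ.image fun l => (Pi.single i (bas i l) : M))
  refine ⟨b, funext fun i => (bas i).ext fun l => ?_⟩
  have h := congrFun (hb (Pi.single i (bas i l)) (by
    simp only [Finset.mem_biUnion, Finset.mem_image, Finset.mem_univ, true_and]
    exact ⟨i, l, rfl⟩)) i
  change φ i ((Pi.single i (bas i l) : M) i) = b • ((Pi.single i (bas i l) : M) i) at h
  rw [Pi.single_eq_same] at h
  exact h.symm

instance (S : SimpleClass (k ⊗[R] A)) : Nontrivial S.rep :=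
  IsSimpleModule.nontrivial (k ⊗[R] A) S.rep

/-- More than `dim A^k` nonisomorphic simples would make the algebra surject onto a product of
nonzero endomorphism spaces of larger dimension. -/
theorem finite_simpleClass (hs : IsSplitAlgebra k (k ⊗[R] A)) :
    Finite (SimpleClass (k ⊗[R] A)) := by
  by_contra hinf
  rw [not_finite_iff_infinite] at hinf
  let T : Fin (Module.finrank k (k ⊗[R] A) + 1) → SimpleClass (k ⊗[R] A) :=
    fun i => Infinite.natEmbedding _ i
  have hT : Function.Injective T :=
    (Infinite.natEmbedding _).injective.comp Fin.val_injective
  have h := LinearMap.finrank_le_finrank_of_surjective (simpleActions_surjective hs hT)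
  rw [Module.finrank_pi_fintype] at h
  have h1 := Finset.card_nsmul_le_sum (Finset.univ)
    (fun i => Module.finrank k ((T i).rep →ₗ[k] (T i).rep)) 1 fun i _ => by
      rw [Module.finrank_linearMap]
      exact Nat.mul_pos Module.finrank_pos Module.finrank_pos
  simp only [Finset.card_univ, Fintype.card_fin, smul_eq_mul, mul_one] at h1
  omega

/-- The joint action on all simples has the radical as kernel and, by density, all `k`-linear
endomorphisms as image. -/
theorem finrank_jacobson_add_sum_sq (hs : IsSplitAlgebra k (k ⊗[R] A))
    [Fintype (SimpleClass (k ⊗[R] A))] :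
    Module.finrank k (Ring.jacobson (k ⊗[R] A)) +
      ∑ S : SimpleClass (k ⊗[R] A), Module.finrank k S.rep ^ 2 =
        Module.finrank k (k ⊗[R] A) := by
  have hker : LinearMap.ker (simpleActions (k := k) (R := R) (A := A) id) =
      (Ring.jacobson (k ⊗[R] A)).restrictScalars k := by
    ext b
    rw [Submodule.restrictScalars_mem, mem_jacobson_iff_forall_smul_eq_zero, LinearMap.mem_ker,
      funext_iff]
    exact forall_congr' fun S => LinearMap.ext_iff
  have h := LinearMap.finrank_range_add_finrank_ker (simpleActions (k := k) (R := R) (A := A) id)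
  rw [hker, LinearMap.range_eq_top.2 (simpleActions_surjective hs Function.injective_id),
    finrank_top, Module.finrank_pi_fintype] at h
  rw [← h, add_comm]
  congr 1
  refine Finset.sum_congr rfl fun S _ => ?_
  rw [Module.finrank_linearMap, sq]
  rfl

/-- For a split algebra there are elements that detect the multiplicities of simple modules. -/
theorem exists_eigenMult_eq (hs : IsSplitAlgebra k (k ⊗[R] A)) :
    ∃ a : SimpleClass (k ⊗[R] A) → k ⊗[R] A, ∀ T,
      eigenMult T.rep (a T) = 1 ∧ ∀ S, S ≠ T → eigenMult S.rep (a T) = 0 := by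
  classical
  have := finite_simpleClass hs
  suffices ∀ T : SimpleClass (k ⊗[R] A), ∃ a, eigenMult T.rep a = 1 ∧
      ∀ S, S ≠ T → eigenMult S.rep a = 0 by
    choose a ha using this
    exact ⟨a, ha⟩
  intro T
  obtain ⟨φ, hφ⟩ := exists_rootMultiplicity_charpoly_eq_one k T.rep
  -- On the simples other than `T` the element acts by zero, with characteristic polynomial a power
  -- of `X`, which does not vanish at `1`.
  obtain ⟨a, ha⟩ := simpleActions_surjective hs Function.injective_id
    (Pi.single (M := fun S : SimpleClass (k ⊗[R] A) => S.rep →ₗ[k] S.rep) T φ)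
  have ha' : ∀ S : SimpleClass (k ⊗[R] A), action S.rep a =
    Pi.single (M := fun S : SimpleClass (k ⊗[R] A) => S.rep →ₗ[k] S.rep) T φ S :=
      fun S => congrFun ha S
  refine ⟨a, ?_, fun S hS => ?_⟩
  · rw [eigenMult, ha', Pi.single_eq_same, hφ]
  · rw [eigenMult, ha', Pi.single_eq_of_ne hS, LinearMap.charpoly_zero,
      Polynomial.rootMultiplicity_eq_zero]
    simp

end Split

/-! ### Compatibility of multiplicities with extension of scalars -/

section FieldExtension

variable {R A k : Type u} [CommRing R] [Ring A] [Algebra R A] [Field k]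
  [Algebra R k] (k' : Type u) [Field k'] [Algebra R k'] [Algebra k k'] [IsScalarTower R k k']

theorem G0.extendScalars_cls (V : FGModuleCat.{u} (k ⊗[R] A)) :
    G0.extendScalars k' (G0.cls V) = G0.cls (DecompositionMaps.extendScalars k' V) :=
  G0.lift_cls _ _ _

variable [Module.Finite R A]

/-- A field embedding preserves root multiplicities. Multiplicities can thus be read off after
applying `γ`, which does the work of injectivity of `γ`. -/
theorem G0.eigenMult_extendScalars (a : k ⊗[R] A) (x : G0 (k ⊗[R] A)) :
    G0.eigenMult (scalarMap A k' a) (G0.extendScalars k' x) = G0.eigenMult a x := by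
  suffices (G0.eigenMult (scalarMap A k' a)).comp (G0.extendScalars k') = G0.eigenMult a from
    DFunLike.congr_fun this x
  refine G0.hom_ext fun V => ?_
  rw [AddMonoidHom.comp_apply, G0.extendScalars_cls, G0.eigenMult_cls, G0.eigenMult_cls,
    DecompositionMaps.eigenMult, charpoly_action_extendScalars, DecompositionMaps.eigenMult,
    Polynomial.eq_rootMultiplicity_map (algebraMap k k').injective, map_one]

theorem G0.dim_extendScalars (x : G0 (k ⊗[R] A)) :
    G0.dim (G0.extendScalars k' x) = G0.dim x := by
  suffices G0.dim.comp (G0.extendScalars k') = G0.dim (R := R) (A := A) (k := k) from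
    DFunLike.congr_fun this x
  refine G0.hom_ext fun V => ?_
  rw [AddMonoidHom.comp_apply, G0.extendScalars_cls, G0.dim_cls, G0.dim_cls,
    finrank_extendScalars]

/-- Classes are determined by the multiplicities of simple modules. -/
theorem G0.eq_sum_eigenMult [Fintype (SimpleClass (k ⊗[R] A))]
    {a : SimpleClass (k ⊗[R] A) → k ⊗[R] A}
    (ha : ∀ T, DecompositionMaps.eigenMult T.rep (a T) = 1 ∧
      ∀ S, S ≠ T → DecompositionMaps.eigenMult S.rep (a T) = 0) (x : G0 (k ⊗[R] A)) :
    x = ∑ T, G0.eigenMult (a T) x • T.cls := by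
  suffices AddMonoidHom.id _ = ∑ T, (zmultiplesHom _ T.cls).comp (G0.eigenMult (a T)) by
    simpa using DFunLike.congr_fun this x
  refine G0.hom_ext_simple fun S => ?_
  rw [AddMonoidHom.finsetSum_apply, Finset.sum_eq_single S]
  · simp [S.cls_eq, (ha S).1]
  · intro T _ hT
    simp [S.cls_eq, (ha T).2 S hT.symm]
  · simp

/-- Every simple module is a quotient of the regular one, and `eigenMult` is additive. -/
theorem eigenMult_rep_le_regularModule (a : k ⊗[R] A) (T : SimpleClass (k ⊗[R] A)) :
    eigenMult T.rep a ≤ eigenMult (regularModule R A k) a := by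
  obtain ⟨s, hs⟩ := exists_ne (0 : T.rep)
  have : IsNoetherianRing (k ⊗[R] A) := IsNoetherianRing.of_finite k _
  let g : regularModule R A k →ₗ[k ⊗[R] A] T.rep :=
    LinearMap.toSpanSingleton (k ⊗[R] A) T.rep s
  have hg : Function.Surjective g :=
    IsSimpleModule.toSpanSingleton_surjective (k ⊗[R] A) hs
  let N := FGModuleCat.of (k ⊗[R] A) (LinearMap.ker g)
  let f : N →ₗ[k ⊗[R] A] regularModule R A k := (LinearMap.ker g).subtype
  have hfg : Function.Exact f g := fun x =>
    ⟨fun h => ⟨⟨x, h⟩, rfl⟩, by rintro ⟨y, rfl⟩; exact y.2⟩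
  rw [eigenMult_eq_add (f := f) (g := g) (LinearMap.ker g).injective_subtype hfg hg a]
  exact Nat.le_add_left _ _

end FieldExtension

/-! ### Specialization along a gate -/

section Gate

variable {R K A : Type u} [CommRing R] [Field K] [Algebra R K] [Ring A] [Algebra R A]

-- The algebra structure of `k(m)` over `k(p)` is local to `residueG0Map`; it is unpacked here once,
-- leaving only statements free of it.
variable (A) in
theorem exists_scalarMap_residueG0Map [Module.Finite R A] (p : Ideal R) [p.IsPrime]
    (O : Subalgebra R K)
    [IsLocalRing O] (h : (maximalIdeal O).comap (algebraMap R O) = p) :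
    (∃ ρ : p.ResidueField ⊗[R] A → ResidueField O ⊗[R] A,
      ∀ a x, G0.eigenMult (ρ a) (residueG0Map A p O h x) = G0.eigenMult a x) ∧
    (∀ x, G0.dim (residueG0Map A p O h x) = G0.dim x) ∧
    residueG0Map A p O h (G0.cls (regularModule R A p.ResidueField)) =
      G0.cls (regularModule R A (ResidueField O)) := by
  let : Algebra p.ResidueField (ResidueField O) := (residueFieldMap p O h).toRingHom.toAlgebra
  have : IsScalarTower R p.ResidueField (ResidueField O) :=
    .of_algebraMap_eq fun r => ((residueFieldMap p O h).commutes r).symm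
  refine ⟨⟨scalarMap A (ResidueField O), G0.eigenMult_extendScalars (ResidueField O)⟩,
    G0.dim_extendScalars (ResidueField O), ?_⟩
  exact (G0.extendScalars_cls _ _).trans
    (G0.cls_eq_of_equiv (extendScalarsRegularEquiv R A p.ResidueField (ResidueField O)))

variable {O : Subalgebra R K}

theorem IsFreeForm.charpoly_map [Module.Finite R A] {W : FGModuleCat.{u} (O ⊗[R] A)}
    {V : FGModuleCat.{u} (K ⊗[R] A)} [Module.Free O W] (h : IsFreeForm O W V) (c : O ⊗[R] A) :
    (action W c).charpoly.map (algebraMap O K) = (action V (scalarMap A K c)).charpoly := by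
  obtain ⟨-, ⟨e⟩⟩ := h
  rw [← charpoly_action_extendScalars]
  exact charpoly_action_eq_of_equiv e _

theorem IsFreeForm.finrank_eq {W : FGModuleCat.{u} (O ⊗[R] A)} {V : FGModuleCat.{u} (K ⊗[R] A)}
    (h : IsFreeForm O W V) : Module.finrank O W = Module.finrank K V := by
  obtain ⟨hW, ⟨e⟩⟩ := h
  rw [← finrank_extendScalars K W]
  exact (e.restrictScalars K).finrank_eq

variable (A) in
theorem isFreeForm_regularModule [Module.Free R A] :
    IsFreeForm O (regularModule R A O) (regularModule R A K) :=
  ⟨.of_equiv (regularEquiv R A O).symm, ⟨extendScalarsRegularEquiv R A O K⟩⟩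

variable [Module.Finite R A] [IsLocalRing O]

/-- The multiplicity of the eigenvalue `1` on the reductions of forms is well defined and
additive. -/
theorem IsWeakGate.exists_eigenMult_reduction {p : Ideal R} (hO : IsWeakGate A p O)
    (a : ResidueField O ⊗[R] A) :
    ∃ δ : G0 (K ⊗[R] A) →+ ℤ, ∀ (V : FGModuleCat.{u} (K ⊗[R] A))
      (W : FGModuleCat.{u} (O ⊗[R] A)), IsFreeForm O W V →
        δ (G0.cls V) = eigenMult (extendScalars (ResidueField O) W) a := by
  obtain ⟨c, rfl⟩ : ∃ c : O ⊗[R] A, scalarMap A (ResidueField O) c = a :=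
    TensorProduct.map_surjective (g := (IsScalarTower.toAlgHom R O (ResidueField O)).toLinearMap)
      (g' := LinearMap.id) IsLocalRing.residue_surjective Function.surjective_id a
  choose W hW using hO.exists_form
  -- The chosen forms of the terms of an exact sequence need not form an exact sequence themselves;
  -- identities between characteristic polynomials over `O` are checked over `K` instead.
  have hinj : Function.Injective (Polynomial.map (algebraMap O K)) :=
    Polynomial.map_injective _ Subtype.val_injective
  have hmult : ∀ (W : FGModuleCat.{u} (O ⊗[R] A)) [Module.Free O W],
      eigenMult (extendScalars (ResidueField O) W) (scalarMap A (ResidueField O) c) =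
        ((action W c).charpoly.map (algebraMap O (ResidueField O))).rootMultiplicity 1 :=
    fun W _ => by rw [eigenMult, charpoly_action_extendScalars]
  refine ⟨G0.lift (fun V => (eigenMult (extendScalars (ResidueField O) (W V))
    (scalarMap A (ResidueField O) c) : ℤ)) fun V' V V'' _ _ hf hfg hg => ?_, fun V W₁ h₁ => ?_⟩
  · have := (hW V).1
    have := (hW V').1
    have := (hW V'').1
    have h : (action (W V) c).charpoly =
        (action (W V') c).charpoly * (action (W V'') c).charpoly := by
      apply hinj
      rw [Polynomial.map_mul, (hW _).charpoly_map, (hW _).charpoly_map, (hW _).charpoly_map,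
        charpoly_action_eq_mul hf hfg hg]
    rw [hmult, hmult, hmult, h, Polynomial.map_mul,
      Polynomial.rootMultiplicity_mul, Nat.cast_add]
    exact mul_ne_zero ((LinearMap.charpoly_monic _).map _).ne_zero
      ((LinearMap.charpoly_monic _).map _).ne_zero
  · have := (hW V).1
    have := h₁.1
    rw [G0.lift_cls, hmult, hmult]
    congr 3
    apply hinj
    rw [(hW _).charpoly_map, h₁.charpoly_map]

theorem dim_reductionClass {W : FGModuleCat.{u} (O ⊗[R] A)} {V : FGModuleCat.{u} (K ⊗[R] A)}
    (h : IsFreeForm O W V) : G0.dim (reductionClass O W) = Module.finrank K V := by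
  have := h.1
  rw [reductionClass, G0.dim_cls, finrank_extendScalars, h.finrank_eq]

theorem isTrivial_of_sum_sq_eq [Module.Free R A] {p : Ideal R} [p.IsPrime]
    (hAp : IsSplitAlgebra p.ResidueField (p.ResidueField ⊗[R] A)) (hO : IsGate A p O)
    {d : G0 (K ⊗[R] A) →+ G0 (p.ResidueField ⊗[R] A)} (hd : IsDecompositionMap hO d)
    [Fintype (SimpleClass (K ⊗[R] A))] [Fintype (SimpleClass (p.ResidueField ⊗[R] A))]
    (hsq : ∑ S : SimpleClass (K ⊗[R] A), Module.finrank K S.rep ^ 2 =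
      ∑ T : SimpleClass (p.ResidueField ⊗[R] A), Module.finrank p.ResidueField T.rep ^ 2) :
    IsTrivial d := by
  obtain ⟨⟨ρ, hρ⟩, hdim, hreg⟩ := exists_scalarMap_residueG0Map A p O hO.comap_eq
  obtain ⟨a, ha⟩ := exists_eigenMult_eq hAp
  choose W hW using hO.exists_form
  -- The decomposition matrix: `D S T` is the multiplicity of `T` in `d [S]`, computed on a
  -- reduction over `k(m)`.
  let D : SimpleClass (K ⊗[R] A) → SimpleClass (p.ResidueField ⊗[R] A) → ℕ := fun S T =>
    eigenMult (extendScalars (ResidueField O) (W S.rep)) (ρ (a T))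
  have hmult : ∀ V W, IsFreeForm O W V → ∀ T, G0.eigenMult (a T) (d (G0.cls V)) =
      eigenMult (extendScalars (ResidueField O) W) (ρ (a T)) := fun V W h T => by
    rw [← hρ, hd V W h, reductionClass, G0.eigenMult_cls]
  have hdS : ∀ S : SimpleClass (K ⊗[R] A), d S.cls = ∑ T, (D S T : ℤ) • T.cls := fun S => by
    rw [G0.eq_sum_eigenMult ha (d S.cls)]
    refine Finset.sum_congr rfl fun T _ => ?_
    rw [S.cls_eq, hmult _ _ (hW S.rep)]
  have hn : ∀ S : SimpleClass (K ⊗[R] A),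
      Module.finrank K S.rep = ∑ T, D S T * Module.finrank p.ResidueField T.rep := fun S => by
    have h := dim_reductionClass (hW S.rep)
    rw [← hd _ _ (hW S.rep), hdim, ← S.cls_eq, hdS] at h
    simp only [map_sum, map_zsmul, SimpleClass.cls_eq, G0.dim_cls, smul_eq_mul] at h
    exact_mod_cast h.symm
  -- If column `T` vanished, `T` would have multiplicity zero in every `d [V]`. For `V` the regular
  -- module this multiplicity is that of `T` in the regular `A(p)`-module, hence nonzero.
  have hcol : ∀ T, ∃ S, D S T ≠ 0 := fun T => by
    by_contra! h
    have h0 : (G0.eigenMult (a T)).comp d = 0 := G0.hom_ext_simple fun S => by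
      rw [AddMonoidHom.comp_apply, S.cls_eq, hmult _ _ (hW S.rep), AddMonoidHom.zero_apply]
      exact_mod_cast h S
    have h1 := DFunLike.congr_fun h0 (G0.cls (regularModule R A K))
    rw [AddMonoidHom.comp_apply, ← hρ, hd _ _ (isFreeForm_regularModule A), reductionClass,
      G0.cls_eq_of_equiv (extendScalarsRegularEquiv R A O (ResidueField O)), ← hreg, hρ,
      G0.eigenMult_cls, AddMonoidHom.zero_apply, Nat.cast_eq_zero] at h1
    have h2 := eigenMult_rep_le_regularModule (a T) T
    rw [h1, (ha T).1] at h2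
    exact Nat.not_succ_le_zero 0 h2
  obtain ⟨e, he⟩ := exists_equiv_of_sum_sq_eq D
    (fun T => Module.finrank p.ResidueField T.rep) (fun T => Module.finrank_pos)
    (fun S => by rw [← hn]; exact Module.finrank_pos) hcol (by simpa only [← hn] using hsq)
  refine ⟨e, fun S => ?_⟩
  rw [hdS, Finset.sum_eq_single (e S), (he S).1, Nat.cast_one, one_smul]
  · intro T _ hT
    rw [(he S).2 T hT, Nat.cast_zero, zero_smul]
  · simp

theorem exists_unique_isDecompositionMap {p : Ideal R} [p.IsPrime]
    (hAp : IsSplitAlgebra p.ResidueField (p.ResidueField ⊗[R] A)) (hO : IsGate A p O) :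
    ∃ d : G0 (K ⊗[R] A) →+ G0 (p.ResidueField ⊗[R] A),
      IsDecompositionMap hO d ∧ ∀ d', IsDecompositionMap hO d' → d' = d := by
  obtain ⟨⟨ρ, hρ⟩, -, -⟩ := exists_scalarMap_residueG0Map A p O hO.comap_eq
  obtain ⟨a, ha⟩ := exists_eigenMult_eq hAp
  have := finite_simpleClass hAp
  have := Fintype.ofFinite (SimpleClass (p.ResidueField ⊗[R] A))
  choose δ hδ using fun T => hO.exists_eigenMult_reduction (ρ (a T))
  let d : G0 (K ⊗[R] A) →+ G0 (p.ResidueField ⊗[R] A) :=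
    ∑ T, (zmultiplesHom _ T.cls).comp (δ T)
  -- Any preimage under `γ` of the reduction class equals `d [V]`. With `y` from the gate condition
  -- this gives existence, with `y = d' [V]` uniqueness.
  have hd : ∀ V W, IsFreeForm O W V → ∀ y,
      residueG0Map A p O hO.comap_eq y = reductionClass O W → y = d (G0.cls V) := fun V W h y hy => by
    rw [G0.eq_sum_eigenMult ha y, AddMonoidHom.finsetSum_apply]
    refine Finset.sum_congr rfl fun T _ => ?_
    rw [AddMonoidHom.comp_apply, zmultiplesHom_apply, hδ T V W h, ← hρ, hy, reductionClass,
      G0.eigenMult_cls]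
  refine ⟨d, fun V W h => ?_, fun d' hd' => G0.hom_ext fun V => ?_⟩
  · obtain ⟨y, hy⟩ := hO.reduction_mem W h.1
    rw [← hd V W h y hy, hy]
  · obtain ⟨W, h⟩ := hO.exists_form V
    exact hd V W h _ (hd' V W h)

end Gate

end

end DecompositionMaps

open DecompositionMaps in
/-- If `A^K` and `A(p)` are split, `O` is a discrete `A`-gate in `p` and the Jacobson radicals of
`A(p)` and `A^K` have the same dimension, then the decomposition map of `A` in `p` with respect to
`O` is trivial. -/
theorem theorem3p3 {R K A : Type u} [CommRing R] [IsDomain R] [Field K] [Algebra R K]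
    [IsFractionRing R K] [Ring A] [Algebra R A] [Module.Free R A] [Module.Finite R A]
    (p : Ideal R) [p.IsPrime]
    (hAK : IsSplitAlgebra K (K ⊗[R] A))
    (hAp : IsSplitAlgebra p.ResidueField (p.ResidueField ⊗[R] A))
    (O : Subalgebra R K) [IsDiscreteValuationRing O] (hO : IsGate A p O)
    (hdim : Module.finrank p.ResidueField (Ring.jacobson (p.ResidueField ⊗[R] A)) =
      Module.finrank K (Ring.jacobson (K ⊗[R] A))) :
    ∃ d : G0 (K ⊗[R] A) →+ G0 (p.ResidueField ⊗[R] A),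
      IsDecompositionMap hO d ∧ (∀ d', IsDecompositionMap hO d' → d' = d) ∧ IsTrivial d := by
  obtain ⟨d, hd, huniq⟩ := exists_unique_isDecompositionMap hAp hO
  have := finite_simpleClass hAK
  have := finite_simpleClass hAp
  have := Fintype.ofFinite (SimpleClass (K ⊗[R] A))
  have := Fintype.ofFinite (SimpleClass (p.ResidueField ⊗[R] A))
  refine ⟨d, hd, huniq, isTrivial_of_sum_sq_eq hAp hO hd ?_⟩
  have h1 := finrank_jacobson_add_sum_sq hAK
  have h2 := finrank_jacobson_add_sum_sq hAp
  -- Both algebras have dimension the rank of `A`, so equal radicals leave equal sums of squares.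
  rw [Module.finrank_baseChange] at h1 h2
  omega
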